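/- Let $p$ be a prime, let $v_p:\mathbf{C}_p\to\mathbf{R}\cup\{+\infty\}$ be the $p$-adic valuation with $v_p(p)=1$, and let $F(X)=\sum_{i\ge 0}F_iX^i\in\mathbf{C}_p[[X]]$ with $F_0\neq 0$. The characteristic sequence $k_0,k_1,\dots$ of $F$ (finite or infinite) is defined as follows: $k_0=0$, and if $k_{m-1}$ is defined, then $k_m$ is the largest integer at which the function $$l_m(n)=\frac{v_p(F_{k_{m-1}})-v_p(F_n)}{n-k_{m-1}}\qquad(n>k_{m-1})$$ attains its maximum; if there is no such integer (the supremum is not attained, or is attained infinitely often), the sequence ends with $k_{m-1}$. (Here $l_m(n)=-\infty$ if $F_n=0$.) Whenever $k_n$ is defined, $F_{k_n}\ne 0$; for $n\geq 1$ with $k_n$ defined, put $$\alpha_n=\frac{v_p(F_{k_{n-1}})-v_p(F_{k_n})}{k_n-k_{n-1}}\in\mathbf{R}.$$ A root of $F$ is an element $x\in\mathbf{C}_p$ at which $F$ converges and such that $F(x)=0$. Then: 1. The (finite or infinite) sequence $(\alpha_n)_{n\ge1}$ is strictly decreasing. 2. For each $n\ge 1$ such that $k_n$ is defined, the number of roots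 $x$ of $F$ with $v_p(x)=\alpha_n$ is finite and, counted with multiplicity (the order of vanishing at $x$ of the function defined by $F$), is equal to $k_n-k_{n-1}$. The only possible exception is the case that $k_n$ is the last term of the characteristic sequence and $F$ converges at no point $x$ with $v_p(x)=\alpha_n$. 3. For every root $x$ of $F$ there is an $n\ge 1$ such that $k_n$ is defined and $v_p(x)=\alpha_n$. Thus the roots of $F$ are partitioned into groups, the $n$-th of which consists of the $k_n-k_{n-1}$ roots of valuation $\alpha_n$. -/

import Mathlib

open scoped Classical in
/-- The `p`-adic valuation on `ℂ_[p]`, normalised by `v_p(p) = 1`, with `v_p(0) = +∞`. -/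
noncomputable def vp (p : ℕ) [Fact p.Prime] (x : ℂ_[p]) : EReal :=
  if x = 0 then ⊤ else ((-Real.logb p ‖x‖ : ℝ) : EReal)

/-- The quotient `(v_p(F_k) - v_p(F_n)) / (n - k)`, meant for `k < n` and `F_k ≠ 0`. It is `-∞`
when `F_n = 0`. -/
noncomputable def slopeBetween {p : ℕ} [Fact p.Prime] (F : PowerSeries ℂ_[p]) (k n : ℕ) : EReal :=
  (vp p (PowerSeries.coeff k F) - vp p (PowerSeries.coeff n F)) / (((n : ℝ) - (k : ℝ) : ℝ) : EReal)

/-- `k'` is the largest integer at which `n ↦ (v_p(F_k) - v_p(F_n)) / (n - k)`, `n > k`, attains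
its maximum. No such `k'` exists when the supremum is not attained, or is attained infinitely
often (in particular when `F_n = 0` for all `n > k`). -/
def IsNextBreak {p : ℕ} [Fact p.Prime] (F : PowerSeries ℂ_[p]) (k k' : ℕ) : Prop :=
  k < k' ∧ (∀ n, k < n → slopeBetween F k n ≤ slopeBetween F k k') ∧
    (∀ n, k < n → slopeBetween F k n = slopeBetween F k k' → n ≤ k')

open scoped Classical in
/-- The characteristic sequence `k_0 = 0, k_1, k_2, …` of `F`, finite or infinite: the value is
`some k_n` as long as the algorithm has not stopped, and `none` from then on. -/
noncomputable def charSeq {p : ℕ} [Fact p.Prime] (F : PowerSeries ℂ_[p]) : ℕ → Option ℕ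
  | 0 => some 0
  | n + 1 => (charSeq F n).bind fun k =>
      if h : ∃ k', IsNextBreak F k k' then some h.choose else none

/-- `F` converges at `x`. -/
def ConvergesAt {p : ℕ} [Fact p.Prime] (F : PowerSeries ℂ_[p]) (x : ℂ_[p]) : Prop :=
  Summable fun n : ℕ => PowerSeries.coeff n F * x ^ n

/-- The function `x ↦ F(x)` (meaningful on the region of convergence). -/
noncomputable def evalSeries {p : ℕ} [Fact p.Prime] (F : PowerSeries ℂ_[p]) (x : ℂ_[p]) : ℂ_[p] :=
  ∑' n : ℕ, PowerSeries.coeff n F * x ^ n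

/-- `x` is a root of `F`: it lies in the region of convergence of `F`, and `F(x) = 0`. -/
def IsSeriesRoot {p : ℕ} [Fact p.Prime] (F : PowerSeries ℂ_[p]) (x : ℂ_[p]) : Prop :=
  ConvergesAt F x ∧ evalSeries F x = 0

/-! Fix a radius `r` at which the terms `‖F_i‖ r ^ i` tend to zero, and let `k` and `l` be the first
and last indices where they are maximal. By the ultrametric inequality, multiplying a series by `X -
a` raises `l` by one exactly when `‖a‖ ≤ r`, and `k` by one exactly when `‖a‖ < r`
(`NewtonEdge.mul_X_sub`). If `l > 0` the series has a root in the closed disc, obtained as a limit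
of roots of truncations (`exists_seriesEval_eq_zero`). Dividing out roots one at a time gives `l`
linear factors, `k` of them with root of norm less than `r`, and a factor without zeros
(`exists_factorization`). Hence the circle of radius `r` carries `l - k` roots with multiplicity.

It remains to match edges with the characteristic sequence. After taking logarithms, comparing a
slope with the valuation attached to `r` is comparing two terms at radius `r`. Consecutive terms of
the sequence are therefore the ends of an edge (`newtonEdge_of_charSeq`), and the left end of any
edge occurs in the sequence (`NewtonEdge.exists_charSeq_eq`), so no root is missed. -/

open Filter Topology

/-! ### Newton edges, and polynomials over an ultrametric field -/

section UltrametricSeries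

variable {K : Type*} [NontriviallyNormedField K]

/-- The value at `x` of the power series with coefficient sequence `f`. -/
noncomputable def seriesEval (f : ℕ → K) (x : K) : K := ∑' n, f n * x ^ n

/-- The series with coefficients `f` converges on the closed disc of radius `r`. -/
def ConvergesOnDisc (f : ℕ → K) (r : ℝ) : Prop := Tendsto (fun n => ‖f n‖ * r ^ n) atTop (𝓝 0)

/-- The coefficients of the quotient of the series `f` by `X - a`. -/
noncomputable def seriesQuot (f : ℕ → K) (a : K) (j : ℕ) : K := ∑' i, f (j + 1 + i) * a ^ i

/-- `M` is the maximum of `‖f i‖ * r ^ i`; it is attained first at `k` and last at `l`. -/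
structure NewtonEdge (f : ℕ → K) (r : ℝ) (k l : ℕ) (M : ℝ) : Prop where
  pos : 0 < M
  le : ∀ i, ‖f i‖ * r ^ i ≤ M
  left : ‖f k‖ * r ^ k = M
  right : ‖f l‖ * r ^ l = M
  lt_left : ∀ i < k, ‖f i‖ * r ^ i < M
  lt_right : ∀ i, l < i → ‖f i‖ * r ^ i < M

lemma NewtonEdge.left_le_right {f : ℕ → K} {r : ℝ} {k l : ℕ} {M : ℝ} (h : NewtonEdge f r k l M) :
    k ≤ l := by
  by_contra! hlt
  exact (h.lt_left l hlt).ne h.right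

lemma NewtonEdge.unique {f : ℕ → K} {r : ℝ} {k l k' l' : ℕ} {M M' : ℝ}
    (h : NewtonEdge f r k l M) (h' : NewtonEdge f r k' l' M') : k = k' ∧ l = l' ∧ M = M' := by
  have hM : M = M' := le_antisymm (h.left ▸ h'.le k) (h'.left ▸ h.le k')
  subst hM
  refine ⟨?_, ?_, rfl⟩
  · rcases lt_trichotomy k k' with hlt | he | hlt
    · exact absurd h.left (h'.lt_left k hlt).ne
    · exact he
    · exact absurd h'.left (h.lt_left k' hlt).ne
  · rcases lt_trichotomy l l' with hlt | he | hlt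
    · exact absurd h'.right (h.lt_right l' hlt).ne
    · exact he
    · exact absurd h.right (h'.lt_right l hlt).ne

/-- Since the terms tend to zero, only finitely many reach the positive value at `i₀`; the maximum
and its extreme indices are sought among these. -/
lemma ConvergesOnDisc.exists_newtonEdge {f : ℕ → K} {r : ℝ} (hr : 0 < r)
    (hf : ConvergesOnDisc f r) {i₀ : ℕ} (h0 : f i₀ ≠ 0) : ∃ k l M, NewtonEdge f r k l M := by
  set w : ℕ → ℝ := fun i => ‖f i‖ * r ^ i with hw
  have hpos : 0 < w i₀ := by positivity
  have hfin : {i | w i₀ ≤ w i}.Finite := by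
    have := (hf.eventually_lt_const hpos)
    rw [← Nat.cofinite_eq_atTop, Filter.eventually_cofinite] at this
    simpa using this
  obtain ⟨m, hm, hmax⟩ := hfin.toFinset.exists_max_image w ⟨i₀, by simp⟩
  have hm' : w i₀ ≤ w m := by simpa using hm
  have hle : ∀ i, w i ≤ w m := by
    intro i
    by_cases hi : w i₀ ≤ w i
    · exact hmax i (by simpa using hi)
    · exact (not_le.1 hi).le.trans hm'
  have hfin' : {i | w i = w m}.Finite := hfin.subset fun i hi => hm'.trans_eq (Eq.symm hi)
  have hne : hfin'.toFinset.Nonempty := ⟨m, by simp⟩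
  refine ⟨hfin'.toFinset.min' hne, hfin'.toFinset.max' hne, w m, hpos.trans_le hm', hle,
    ?_, ?_, ?_, ?_⟩
  · simpa using hfin'.toFinset.min'_mem hne
  · simpa using hfin'.toFinset.max'_mem hne
  · intro i hi
    refine (hle i).lt_of_ne fun he => ?_
    exact absurd (hfin'.toFinset.min'_le i (by simpa using he)) (not_le.2 hi)
  · intro i hi
    refine (hle i).lt_of_ne fun he => ?_
    exact absurd (hfin'.toFinset.le_max' i (by simpa using he)) (not_le.2 hi)

lemma NewtonEdge.const_mul {f : ℕ → K} {r : ℝ} {k l : ℕ} {M : ℝ} (h : NewtonEdge f r k l M)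
    {c : K} (hc : c ≠ 0) : NewtonEdge (fun i => c * f i) r k l (‖c‖ * M) := by
  have hc' : 0 < ‖c‖ := norm_pos_iff.2 hc
  have hM := h.pos
  refine ⟨by positivity, ?_, ?_, ?_, ?_, ?_⟩
  · intro i; rw [norm_mul, mul_assoc]; exact mul_le_mul_of_nonneg_left (h.le i) hc'.le
  · rw [norm_mul, mul_assoc, h.left]
  · rw [norm_mul, mul_assoc, h.right]
  · intro i hi; rw [norm_mul, mul_assoc]; exact mul_lt_mul_of_pos_left (h.lt_left i hi) hc'
  · intro i hi; rw [norm_mul, mul_assoc]; exact mul_lt_mul_of_pos_left (h.lt_right i hi) hc'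

variable [IsUltrametricDist K]

lemma norm_sub_eq_left_of_lt {x y : K} (h : ‖y‖ < ‖x‖) : ‖x - y‖ = ‖x‖ := by
  rw [sub_eq_add_neg, IsUltrametricDist.norm_add_eq_max_of_norm_ne_norm (by simpa using h.ne'),
    norm_neg, max_eq_left h.le]

lemma norm_sub_eq_right_of_lt {x y : K} (h : ‖x‖ < ‖y‖) : ‖x - y‖ = ‖y‖ := by
  rw [norm_sub_rev, norm_sub_eq_left_of_lt h]

lemma norm_sub_le_max' (x y : K) : ‖x - y‖ ≤ max ‖x‖ ‖y‖ := by
  simpa [sub_eq_add_neg] using IsUltrametricDist.norm_add_le_max x (-y)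

/-- Effect on the Newton edge of multiplication by `X - a`. -/
lemma NewtonEdge.mul_X_sub {f h : ℕ → K} {a : K} {r : ℝ} (hr : 0 < r) {k l : ℕ} {M : ℝ}
    (hh : NewtonEdge h r k l M) (h0 : f 0 = -(a * h 0))
    (hs : ∀ n, f (n + 1) = h n - a * h (n + 1)) :
    NewtonEdge f r (k + if ‖a‖ < r then 1 else 0) (l + if ‖a‖ ≤ r then 1 else 0)
      (M * max r ‖a‖) := by
  have hM := hh.pos
  set R := max r ‖a‖ with hR
  have hrR : r ≤ R := le_max_left _ _
  have haR : ‖a‖ ≤ R := le_max_right _ _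
  have hR0 : 0 < R := hr.trans_le hrR
  set A : ℕ → ℝ := fun n => ‖h n‖ * r ^ n with hA
  have z0 : ‖f 0‖ * r ^ 0 = A 0 * ‖a‖ := by simp [h0, hA, mul_comm]
  have e1 : ∀ n, ‖h n‖ * r ^ (n + 1) = A n * r := fun n => by simp only [hA]; ring
  have e2 : ∀ n, ‖a * h (n + 1)‖ * r ^ (n + 1) = A (n + 1) * ‖a‖ := fun n => by
    simp only [hA, norm_mul]; ring
  have up : ∀ n, ‖f (n + 1)‖ * r ^ (n + 1) ≤ max (A n * r) (A (n + 1) * ‖a‖) := by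
    intro n
    rw [← e1, ← e2, ← max_mul_of_nonneg _ _ (by positivity), hs]
    gcongr
    exact norm_sub_le_max' _ _
  have eL : ∀ n, A (n + 1) * ‖a‖ < A n * r → ‖f (n + 1)‖ * r ^ (n + 1) = A n * r := by
    intro n hn
    rw [← e1, ← e2] at hn
    rw [hs, norm_sub_eq_left_of_lt (lt_of_mul_lt_mul_right hn (by positivity)), e1]
  have eR : ∀ n, A n * r < A (n + 1) * ‖a‖ → ‖f (n + 1)‖ * r ^ (n + 1) = A (n + 1) * ‖a‖ := by
    intro n hn
    rw [← e1, ← e2] at hn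
    rw [hs, norm_sub_eq_right_of_lt (lt_of_mul_lt_mul_right hn (by positivity)), e2]
  have hA0 : ∀ n, 0 ≤ A n := fun n => by positivity
  have b1 : ∀ n, A n * r ≤ M * R := fun n => mul_le_mul (hh.le n) hrR hr.le hM.le
  have b2 : ∀ n, A n * ‖a‖ ≤ M * R := fun n => mul_le_mul (hh.le n) haR (norm_nonneg _) hM.le
  -- Strictness has two sources: in `c1` and `c2` the index is not maximal for `h`, in `d1` and `d2`
  -- the factor `r` or `‖a‖` is smaller than `R`.
  have c1 : ∀ n, A n < M → A n * r < M * R := fun n hn =>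
    (mul_lt_mul_of_pos_right hn hr).trans_le (by gcongr)
  have c2 : ∀ n, A n < M → A n * ‖a‖ < M * R := fun n hn =>
    (mul_le_mul_of_nonneg_left haR (hA0 n)).trans_lt (mul_lt_mul_of_pos_right hn hR0)
  have d1 : r < R → ∀ n, A n * r < M * R := fun hlt n =>
    (mul_le_mul_of_nonneg_right (hh.le n) hr.le).trans_lt (mul_lt_mul_of_pos_left hlt hM)
  have d2 : ‖a‖ < R → ∀ n, A n * ‖a‖ < M * R := fun hlt n =>
    (mul_le_mul_of_nonneg_right (hh.le n) (norm_nonneg _)).trans_lt (mul_lt_mul_of_pos_left hlt hM)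
  have hAk : A k = M := hh.left
  have hAl : A l = M := hh.right
  have hlt_l : ∀ i < k, A i < M := hh.lt_left
  have hlt_r : ∀ i, l < i → A i < M := hh.lt_right
  have hle : ∀ i, ‖f i‖ * r ^ i ≤ M * R := by
    rintro (_ | n)
    · rw [z0]; exact b2 0
    · exact (up n).trans (max_le (b1 n) (b2 _))
  refine ⟨by positivity, hle, ?_, ?_, ?_, ?_⟩
  -- The coefficient of degree `n + 1` is `h n - a * h (n + 1)`. If `‖a‖ < r`, its first part
  -- dominates at `n = k`. Otherwise `a * h k` dominates in degree `k`, because `h` is not maximal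
  -- at `k - 1`. When `‖a‖ = r` only the right end moves, so the edge lengthens.
  · split_ifs with ha
    · have hRr : R = r := max_eq_left ha.le
      rw [eL k, hAk, hRr]
      rw [hAk, ← hRr]; exact d2 (ha.trans_eq hRr.symm) _
    · have hRa : R = ‖a‖ := max_eq_right (not_lt.1 ha)
      rcases k with _ | n
      · rw [add_zero, z0, hAk, hRa]
      · rw [add_zero, eR n, hAk, hRa]
        rw [hAk, ← hRa]; exact c1 n (hlt_l n (by omega))
  · split_ifs with ha
    · have hRr : R = r := max_eq_left ha
      rw [eL l, hAl, hRr]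
      rw [hAl, ← hRr]; exact c2 _ (hlt_r _ (by omega))
    · have hRa : R = ‖a‖ := max_eq_right (not_le.1 ha).le
      rcases l with _ | n
      · rw [add_zero, z0, hAl, hRa]
      · rw [add_zero, eR n, hAl, hRa]
        rw [hAl, ← hRa]; exact d1 (hRa ▸ not_le.1 ha) n
  · split_ifs with ha
    · have hRr : R = r := max_eq_left ha.le
      rintro (_ | n) hi
      · rw [z0]; exact d2 (hRr ▸ ha) 0
      · exact (up n).trans_lt (max_lt (c1 n (hlt_l n (by omega))) (d2 (hRr ▸ ha) _))
    · rintro (_ | n) hi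
      · rw [z0]; exact c2 0 (hlt_l 0 hi)
      · exact (up n).trans_lt (max_lt (c1 n (hlt_l n (by omega))) (c2 _ (hlt_l _ hi)))
  · split_ifs with ha
    · rintro (_ | n) hi
      · omega
      · exact (up n).trans_lt (max_lt (c1 n (hlt_r n (by omega))) (c2 _ (hlt_r _ (by omega))))
    · have hRa : R = ‖a‖ := max_eq_right (not_le.1 ha).le
      rintro (_ | n) hi
      · omega
      · exact (up n).trans_lt (max_lt (d1 (hRa ▸ not_le.1 ha) n) (c2 _ (hlt_r _ (by omega))))

lemma newtonEdge_prod_X_sub_C {r : ℝ} (hr : 0 < r) (S : Multiset K) :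
    ∃ k, NewtonEdge (fun i => (S.map fun a => Polynomial.X - Polynomial.C a).prod.coeff i) r k
      (S.countP (‖·‖ ≤ r)) (S.map fun a => max r ‖a‖).prod := by
  induction S using Multiset.induction_on with
  | empty =>
    refine ⟨0, by simp, ?_, by simp, by simp, by simp, ?_⟩
    · rintro (_ | i) <;> simp [Polynomial.coeff_one]
    · rintro (_ | i) hi
      · simp at hi
      · simp [Polynomial.coeff_one]
  | cons a S ih =>
    obtain ⟨k, hk⟩ := ih
    rw [Multiset.countP_cons, Multiset.map_cons, Multiset.prod_cons, Multiset.map_cons,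
      Multiset.prod_cons, mul_comm (max r ‖a‖)]
    refine ⟨k + if ‖a‖ < r then 1 else 0, ?_⟩
    refine hk.mul_X_sub hr (a := a) ?_ ?_
    · simp [sub_mul]
    · intro n
      simp [sub_mul]

/-- A factor with `‖a‖ > r` has norm exactly `‖a‖` at `y`; each of the others has norm at least `δ *
r`. -/
lemma prod_max_mul_pow_le_norm_eval {r δ : ℝ} (hr : 0 < r) (hδ : 0 ≤ δ) (S : Multiset K)
    {y : K} (hy : ‖y‖ ≤ r) (h : ∀ a ∈ S, ‖a‖ ≤ r → δ * r ≤ ‖y - a‖) :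
    (S.map fun a => max r ‖a‖).prod * δ ^ (S.countP (‖·‖ ≤ r)) ≤
      ‖(S.map fun a => Polynomial.X - Polynomial.C a).prod.eval y‖ := by
  induction S using Multiset.induction_on with
  | empty => simp
  | cons a S ih =>
    have ih' := ih fun b hb => h b (Multiset.mem_cons_of_mem hb)
    have hP : 0 ≤ (S.map fun a => max r ‖a‖).prod := by
      refine Multiset.prod_nonneg ?_
      simp only [Multiset.mem_map]
      rintro _ ⟨b, -, rfl⟩
      exact hr.le.trans (le_max_left _ _)
    rw [Multiset.countP_cons, Multiset.map_cons, Multiset.prod_cons, Multiset.map_cons,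
      Multiset.prod_cons, Polynomial.eval_mul, norm_mul, Polynomial.eval_sub, Polynomial.eval_X,
      Polynomial.eval_C]
    split_ifs with ha
    · rw [max_eq_left ha]
      calc _ = (δ * r) * ((S.map fun a => max r ‖a‖).prod * δ ^ (S.countP (‖·‖ ≤ r))) := by ring
        _ ≤ _ := mul_le_mul (h a (Multiset.mem_cons_self a S) ha) ih'
          (by positivity) (norm_nonneg _)
    · have ha' := not_le.1 ha
      rw [max_eq_right ha'.le, norm_sub_eq_right_of_lt (hy.trans_lt ha'), add_zero, mul_assoc]
      gcongr

/-- A polynomial small at `y` has a root close to `y`. -/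
lemma exists_root_near [IsAlgClosed K] {Q : Polynomial K} {r : ℝ} (hr : 0 < r) {k l : ℕ} {M : ℝ}
    (h : NewtonEdge (fun i => Q.coeff i) r k l M) (hl : 0 < l) {y : K} (hy : ‖y‖ ≤ r) :
    ∃ a, ‖a‖ ≤ r ∧ Q.eval a = 0 ∧ M * (‖y - a‖ / r) ^ l ≤ ‖Q.eval y‖ := by
  have hQ : Q ≠ 0 := by
    rintro rfl
    have h1 := h.left
    have h2 := h.pos
    simp at h1
    exact h2.ne h1
  have hc : Q.leadingCoeff ≠ 0 := by simpa using hQ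
  have hfac : Q = Polynomial.C Q.leadingCoeff *
      (Q.roots.map fun a => Polynomial.X - Polynomial.C a).prod :=
    (IsAlgClosed.splits Q).eq_prod_roots
  obtain ⟨k', hk'⟩ := newtonEdge_prod_X_sub_C hr Q.roots
  have h' := hk'.const_mul hc
  have : (fun i => Q.leadingCoeff *
      ((Q.roots.map fun a => Polynomial.X - Polynomial.C a).prod.coeff i)) =
      fun i => Q.coeff i := by
    funext i
    rw [← Polynomial.coeff_C_mul, ← hfac]
  rw [this] at h'
  obtain ⟨-, hl', hM'⟩ := h.unique h'
  have hpos : 0 < Q.roots.countP (‖·‖ ≤ r) := hl' ▸ hl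
  obtain ⟨a₀, ha₀, ha₀r⟩ := Multiset.countP_pos.1 hpos
  classical
  -- For the root nearest to `y`, all `l` roots in the disc are at distance at least `‖y - a‖`,
  -- whence the exponent `l`.
  obtain ⟨a, ha, hmin⟩ := (Q.roots.toFinset.filter (‖·‖ ≤ r)).exists_min_image (fun a => ‖y - a‖)
    ⟨a₀, by simp only [Finset.mem_filter, Multiset.mem_toFinset]; exact ⟨ha₀, ha₀r⟩⟩
  simp only [Finset.mem_filter, Multiset.mem_toFinset] at ha hmin
  refine ⟨a, ha.2, (Polynomial.mem_roots hQ).1 ha.1, ?_⟩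
  have hb := prod_max_mul_pow_le_norm_eval (δ := ‖y - a‖ / r) hr (by positivity) Q.roots hy
    fun b hb hbr => by
      rw [div_mul_cancel₀ _ hr.ne']
      exact hmin b ⟨hb, hbr⟩
  rw [hM', hl']
  conv_rhs => rw [hfac, Polynomial.eval_mul, Polynomial.eval_C, norm_mul]
  rw [mul_assoc]
  gcongr

end UltrametricSeries

/-! ### Division by `X - a` and analyticity on the closed disc -/

section UltrametricSeries

variable {K : Type*} [NontriviallyNormedField K]

lemma ConvergesOnDisc.shift {f : ℕ → K} {r : ℝ} (hr : 0 < r) (hf : ConvergesOnDisc f r) (m : ℕ) :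
    ConvergesOnDisc (fun i => f (m + i)) r := by
  have h := (((tendsto_add_atTop_iff_nat m).2 hf).div_const (r ^ m))
  rw [zero_div] at h
  refine h.congr fun i => ?_
  rw [add_comm i m, pow_add]
  field_simp

variable [IsUltrametricDist K]

lemma norm_seriesEval_le {f : ℕ → K} {r M : ℝ} (hM : 0 ≤ M) (h : ∀ n, ‖f n‖ * r ^ n ≤ M) {x : K}
    (hx : ‖x‖ ≤ r) : ‖seriesEval f x‖ ≤ M := by
  refine IsUltrametricDist.norm_tsum_le_of_forall_le_of_nonneg hM fun n => ?_
  rw [norm_mul, norm_pow]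
  exact le_trans (by gcongr) (h n)

/-- The `j`-th coefficient of the quotient involves only the `f i` with `i > j`. So the quotient
still converges on the closed disc, and each division costs a factor `r` in the bound. -/
lemma norm_seriesQuot_le {f : ℕ → K} {r M : ℝ} (hr : 0 < r) (hM : 0 ≤ M) {a : K} (ha : ‖a‖ ≤ r)
    {j : ℕ} (h : ∀ i, j < i → ‖f i‖ * r ^ i ≤ M) : ‖seriesQuot f a j‖ * r ^ j ≤ M / r := by
  have : ‖seriesQuot f a j‖ ≤ M / r ^ (j + 1) := by
    refine norm_seriesEval_le (f := fun i => f (j + 1 + i)) (by positivity) (fun n => ?_) ha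
    rw [le_div_iff₀ (by positivity)]
    calc _ = ‖f (j + 1 + n)‖ * r ^ (j + 1 + n) := by ring
      _ ≤ M := h _ (by omega)
  calc _ ≤ M / r ^ (j + 1) * r ^ j := by gcongr
    _ = M / r := by field_simp; ring

lemma ConvergesOnDisc.quot {f : ℕ → K} {r : ℝ} (hr : 0 < r) (hf : ConvergesOnDisc f r)
    {a : K} (ha : ‖a‖ ≤ r) : ConvergesOnDisc (seriesQuot f a) r := by
  refine Metric.tendsto_atTop.2 fun ε hε => ?_
  obtain ⟨N, hN⟩ := Metric.tendsto_atTop.1 hf (ε / 2 * r) (by positivity)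
  refine ⟨N, fun n hn => ?_⟩
  have := norm_seriesQuot_le (f := f) (M := ε / 2 * r) hr (by positivity) ha (j := n)
    fun i hi => by
      have := hN i (by omega)
      rw [Real.dist_eq, sub_zero] at this
      exact ((le_abs_self _).trans_lt this).le
  rw [mul_div_cancel_right₀ _ hr.ne'] at this
  rw [Real.dist_eq, sub_zero, abs_of_nonneg (by positivity)]
  linarith

variable [CompleteSpace K]

lemma ConvergesOnDisc.summable {f : ℕ → K} {r : ℝ} (hf : ConvergesOnDisc f r) {x : K}
    (hx : ‖x‖ ≤ r) : Summable fun n => f n * x ^ n := by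
  refine NonarchimedeanAddGroup.summable_of_tendsto_cofinite_zero ?_
  rw [Nat.cofinite_eq_atTop]
  refine squeeze_zero_norm (fun n => ?_) hf
  rw [norm_mul, norm_pow]
  gcongr

lemma seriesEval_eq_add_mul {f : ℕ → K} {r : ℝ} (hf : ConvergesOnDisc f r) {x : K}
    (hx : ‖x‖ ≤ r) : seriesEval f x = f 0 + x * seriesEval (fun i => f (1 + i)) x := by
  rw [seriesEval, (hf.summable hx).tsum_eq_zero_add, seriesEval, ← tsum_mul_left]
  simp only [pow_zero, mul_one]
  congr 1
  refine tsum_congr fun n => ?_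
  rw [add_comm 1 n]
  ring

lemma coeff_zero_eq_seriesQuot {f : ℕ → K} {r : ℝ} (hf : ConvergesOnDisc f r)
    {a : K} (ha : ‖a‖ ≤ r) : f 0 = seriesEval f a - a * seriesQuot f a 0 := by
  rw [seriesEval_eq_add_mul hf ha]
  simp [seriesQuot, seriesEval]

lemma coeff_succ_eq_seriesQuot {f : ℕ → K} {r : ℝ} (hr : 0 < r) (hf : ConvergesOnDisc f r)
    {a : K} (ha : ‖a‖ ≤ r) (n : ℕ) :
    f (n + 1) = seriesQuot f a n - a * seriesQuot f a (n + 1) := by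
  have h := seriesEval_eq_add_mul (hf.shift hr (n + 1)) ha
  have h1 : seriesQuot f a n = seriesEval (fun i => f (n + 1 + i)) a := rfl
  have h2 : seriesQuot f a (n + 1) = seriesEval (fun i => f (n + 1 + (1 + i))) a := by
    simp only [seriesQuot, seriesEval, add_assoc]
  rw [h1, h2, h]
  simp

lemma seriesEval_eq_add_sub_mul {f : ℕ → K} {r : ℝ} (hr : 0 < r) (hf : ConvergesOnDisc f r)
    {a x : K} (ha : ‖a‖ ≤ r) (hx : ‖x‖ ≤ r) :
    seriesEval f x = seriesEval f a + (x - a) * seriesEval (seriesQuot f a) x := by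
  have hq := hf.quot hr ha
  have hq' := hq.shift hr 1
  have e : seriesEval (fun i => f (1 + i)) x = seriesEval (seriesQuot f a) x -
      a * seriesEval (fun i => seriesQuot f a (1 + i)) x := by
    simp only [seriesEval]
    rw [← tsum_mul_left, ← (hq.summable hx).tsum_sub ((hq'.summable hx).mul_left a)]
    refine tsum_congr fun n => ?_
    rw [add_comm 1 n, coeff_succ_eq_seriesQuot hr hf ha]
    ring
  have e2 := seriesEval_eq_add_mul hq hx
  rw [seriesEval_eq_add_mul hf hx, e, coeff_zero_eq_seriesQuot hf ha]
  linear_combination a * e2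

omit [IsUltrametricDist K] [CompleteSpace K] in
lemma ConvergesOnDisc.bddAbove {f : ℕ → K} {r : ℝ} (hf : ConvergesOnDisc f r) :
    ∃ C, 0 ≤ C ∧ ∀ n, ‖f n‖ * r ^ n ≤ C := by
  obtain ⟨C, hC⟩ := Tendsto.bddAbove_range hf
  exact ⟨max C 0, le_max_right _ _, fun n => (hC ⟨n, rfl⟩).trans (le_max_left _ _)⟩

/-- A series converging on a closed disc is analytic at every point of it, including the
boundary. -/
lemma ConvergesOnDisc.analyticAt {f : ℕ → K} {r : ℝ} (hr : 0 < r) (hf : ConvergesOnDisc f r)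
    {x : K} (hx : ‖x‖ ≤ r) : AnalyticAt K (seriesEval f) x := by
  obtain ⟨C, hC0, hC⟩ := hf.bddAbove
  -- Repeated division by `X - x` produces the Taylor expansion at `x`: the value of `V n` at `x` is
  -- the `n`-th coefficient, and its value at `x + h` gives the remainder in `hpart`.
  set V : ℕ → ℕ → K := fun n => (fun g => seriesQuot g x)^[n] f with hV
  have hVs : ∀ n, V (n + 1) = seriesQuot (V n) x := fun n =>
    Function.iterate_succ_apply' _ _ _
  have hVc : ∀ n, ConvergesOnDisc (V n) r ∧ ∀ j, ‖V n j‖ * r ^ j ≤ C / r ^ n := by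
    intro n
    induction n with
    | zero => exact ⟨hf, by simpa [hV] using hC⟩
    | succ n ih =>
      rw [hVs]
      refine ⟨ih.1.quot hr hx, fun j => ?_⟩
      refine (norm_seriesQuot_le hr (by positivity) hx fun i _ => ih.2 i).trans_eq ?_
      rw [pow_succ]
      field_simp
  have hVn : ∀ n z, ‖z‖ ≤ r → ‖seriesEval (V n) z‖ ≤ C / r ^ n := fun n z hz =>
    norm_seriesEval_le (by positivity) (hVc n).2 hz
  refine ⟨FormalMultilinearSeries.ofScalars K fun n => seriesEval (V n) x, ?_⟩
  rw [hasFPowerSeriesAt_iff]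
  filter_upwards [Metric.ball_mem_nhds (0 : K) hr] with h hh
  have hh' : ‖h‖ < r := by simpa using hh
  have hxh : ‖x + h‖ ≤ r := (IsUltrametricDist.norm_add_le_max _ _).trans (max_le hx hh'.le)
  simp only [FormalMultilinearSeries.coeff_ofScalars, smul_eq_mul]
  have hq1 : ‖h‖ / r < 1 := (div_lt_one hr).2 hh'
  have hsum : Summable fun n => h ^ n * seriesEval (V n) x := by
    refine Summable.of_norm_bounded
      ((summable_geometric_of_lt_one (by positivity) hq1).mul_left C) fun n => ?_
    rw [norm_mul, norm_pow]
    calc _ ≤ ‖h‖ ^ n * (C / r ^ n) := by gcongr; exact hVn n x hx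
      _ = _ := by rw [div_pow]; ring
  have hpart : ∀ n, ∑ m ∈ Finset.range n, h ^ m * seriesEval (V m) x =
      seriesEval f (x + h) - h ^ n * seriesEval (V n) (x + h) := by
    intro n
    induction n with
    | zero => simp [hV]
    | succ n ih =>
      rw [Finset.sum_range_succ, ih, hVs, seriesEval_eq_add_sub_mul hr (hVc n).1 hx hxh]
      ring
  refine hsum.hasSum_iff_tendsto_nat.2 ?_
  simp only [hpart]
  have hlim : Tendsto (fun n => h ^ n * seriesEval (V n) (x + h)) atTop (𝓝 0) := by
    refine squeeze_zero_norm (a := fun n => C * (‖h‖ / r) ^ n) (fun n => ?_) ?_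
    · rw [norm_mul, norm_pow]
      calc _ ≤ ‖h‖ ^ n * (C / r ^ n) := by gcongr; exact hVn n _ hxh
        _ = _ := by rw [div_pow]; ring
    · simpa using (tendsto_pow_atTop_nhds_zero_of_lt_one (by positivity) hq1).const_mul C
  simpa using hlim.const_sub (seriesEval f (x + h))

end UltrametricSeries

/-! ### Existence and count of roots of convergent series -/

section UltrametricSeries

variable {K : Type*} [NontriviallyNormedField K] [IsUltrametricDist K] [CompleteSpace K]

/-- A polynomial truncation. -/
noncomputable def seriesTrunc (f : ℕ → K) (n : ℕ) : Polynomial K :=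
  ∑ i ∈ Finset.range n, Polynomial.monomial i (f i)

omit [IsUltrametricDist K] [CompleteSpace K] in
lemma coeff_seriesTrunc (f : ℕ → K) (n i : ℕ) :
    (seriesTrunc f n).coeff i = if i < n then f i else 0 := by
  simp [seriesTrunc, Polynomial.coeff_monomial]

omit [IsUltrametricDist K] [CompleteSpace K] in
lemma eval_seriesTrunc (f : ℕ → K) (n : ℕ) (x : K) :
    (seriesTrunc f n).eval x = ∑ i ∈ Finset.range n, f i * x ^ i := by
  simp [seriesTrunc, Polynomial.eval_finsetSum]

omit [IsUltrametricDist K] [CompleteSpace K] in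
lemma NewtonEdge.seriesTrunc {f : ℕ → K} {r : ℝ} {k l : ℕ} {M : ℝ} (h : NewtonEdge f r k l M)
    {n : ℕ} (hn : l < n) : NewtonEdge (fun i => (seriesTrunc f n).coeff i) r k l M := by
  have hkl := h.left_le_right
  have hM := h.pos
  simp only [coeff_seriesTrunc]
  refine ⟨hM, fun i => ?_, ?_, ?_, fun i hi => ?_, fun i hi => ?_⟩
  · split_ifs
    · exact h.le i
    · simpa using hM.le
  · rw [if_pos (by omega), h.left]
  · rw [if_pos hn, h.right]
  · rw [if_pos (by omega)]; exact h.lt_left i hi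
  · split_ifs
    · exact h.lt_right i hi
    · simpa using hM

/-- A series whose dominant terms on the closed disc of radius `r` are not only the constant one
has a root in that disc. -/
lemma exists_seriesEval_eq_zero [IsAlgClosed K] {f : ℕ → K} {r : ℝ} (hr : 0 < r)
    (hf : ConvergesOnDisc f r) {k l : ℕ} {M : ℝ} (h : NewtonEdge f r k l M) (hl : 0 < l) :
    ∃ a, ‖a‖ ≤ r ∧ seriesEval f a = 0 := by
  have hM := h.pos
  have hE : ∀ n, NewtonEdge (fun i => (seriesTrunc f (l + 1 + n)).coeff i) r k l M := fun n =>
    h.seriesTrunc (by omega)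
  let Y := fun n : ℕ => {y : K // ‖y‖ ≤ r ∧ (seriesTrunc f (l + 1 + n)).eval y = 0}
  -- At a root of one truncation, the next truncation reduces to its last monomial, which is small,
  -- so it has a root nearby.
  have hstep : ∀ (n : ℕ) (y : Y n), ∃ z : Y (n + 1),
      M * (‖y.1 - z.1‖ / r) ^ l ≤ ‖f (l + 1 + n)‖ * r ^ (l + 1 + n) := by
    rintro n ⟨y, hy, hy0⟩
    obtain ⟨z, hz, hz0, hzy⟩ := exists_root_near hr (hE (n + 1)) hl hy
    refine ⟨⟨z, hz, hz0⟩, hzy.trans ?_⟩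
    rw [eval_seriesTrunc] at hy0
    rw [eval_seriesTrunc, ← add_assoc, Finset.sum_range_succ, hy0, zero_add, norm_mul, norm_pow]
    gcongr
  choose next hnext using hstep
  obtain ⟨y₀, hy₀, hy₀0, -⟩ := exists_root_near hr (hE 0) hl (y := 0) (by simpa using hr.le)
  let y : ∀ n, Y n := fun n => Nat.rec ⟨y₀, hy₀, hy₀0⟩ next n
  have hy : ∀ n, M * (‖(y n).1 - (y (n + 1)).1‖ / r) ^ l ≤ ‖f (l + 1 + n)‖ * r ^ (l + 1 + n) :=
    fun n => hnext n (y n)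
  have hft : Tendsto (fun n => ‖f (l + 1 + n)‖ * r ^ (l + 1 + n)) atTop (𝓝 0) := by
    simp only [add_comm (l + 1)]
    exact (tendsto_add_atTop_iff_nat (l + 1)).2 hf
  have hdiff : Tendsto (fun n => (y (n + 1)).1 - (y n).1) atTop (𝓝 0) := by
    rw [Metric.tendsto_atTop]
    intro ε hε
    obtain ⟨N, hN⟩ := Metric.tendsto_atTop.1 hft (M * (ε / r) ^ l) (by positivity)
    refine ⟨N, fun n hn => ?_⟩
    have h1 := hN n hn
    rw [Real.dist_eq, sub_zero] at h1
    have h2 := ((hy n).trans (le_abs_self _)).trans_lt h1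
    have h3 := lt_of_pow_lt_pow_left₀ l (by positivity) (lt_of_mul_lt_mul_left h2 hM.le)
    rw [dist_zero_right, norm_sub_rev]
    exact (div_lt_div_iff_of_pos_right hr).1 h3
  have hcau : CauchySeq fun n => (y n).1 :=
    NonarchimedeanAddGroup.cauchySeq_of_tendsto_sub_nhds_zero hdiff
  obtain ⟨a, ha⟩ := cauchySeq_tendsto_of_complete hcau
  have har : ‖a‖ ≤ r := le_of_tendsto ha.norm (Eventually.of_forall fun n => (y n).2.1)
  refine ⟨a, har, ?_⟩
  -- The truncation vanishes at `y n`, leaving only the tail of the series.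
  have hlim : Tendsto (fun n => seriesEval f (y n).1) atTop (𝓝 0) := by
    rw [Metric.tendsto_atTop]
    intro ε hε
    obtain ⟨N, hN⟩ := Metric.tendsto_atTop.1 hft (ε / 2) (by positivity)
    refine ⟨N, fun n hn => ?_⟩
    have hs := (hf.summable (y n).2.1).sum_add_tsum_nat_add (l + 1 + n)
    rw [← eval_seriesTrunc, (y n).2.2, zero_add] at hs
    rw [dist_zero_right]
    refine lt_of_le_of_lt ?_ (half_lt_self hε)
    rw [seriesEval, ← hs]
    refine IsUltrametricDist.norm_tsum_le_of_forall_le_of_nonneg (by positivity) fun i => ?_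
    have h1 := hN (i + n) (by omega)
    rw [Real.dist_eq, sub_zero, abs_of_nonneg (by positivity)] at h1
    rw [norm_mul, norm_pow]
    have e : i + (l + 1 + n) = l + 1 + (i + n) := by omega
    rw [e]
    refine le_trans ?_ h1.le
    gcongr
    exact (y n).2.1
  exact tendsto_nhds_unique ((hf.analyticAt hr har).continuousAt.tendsto.comp ha) hlim

/-- A root `a` in the disc would make the series a multiple of `X - a`, forcing the right end of its
edge to be at least `1`. -/
lemma seriesEval_ne_zero {f : ℕ → K} {r : ℝ} (hr : 0 < r)
    (hf : ConvergesOnDisc f r) {M : ℝ} (h : NewtonEdge f r 0 0 M) {a : K} (ha : ‖a‖ ≤ r) :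
    seriesEval f a ≠ 0 := by
  intro h0
  have hz := coeff_zero_eq_seriesQuot hf ha
  rw [h0, zero_sub] at hz
  have hs := coeff_succ_eq_seriesQuot hr hf ha
  have hne : seriesQuot f a 0 ≠ 0 := by
    intro hq
    have := h.left
    rw [hz, hq] at this
    simp at this
    exact h.pos.ne this
  obtain ⟨k, l, M', hE⟩ := (hf.quot hr ha).exists_newtonEdge hr hne
  have := (hE.mul_X_sub hr hz hs).unique h
  simp [ha] at this

/-- Factorisation of a series converging on a closed disc into linear factors, one for each root,
and a series without roots. -/
lemma exists_factorization [IsAlgClosed K] {r : ℝ} (hr : 0 < r) {l : ℕ} :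
    ∀ {f : ℕ → K} {k : ℕ} {M : ℝ}, ConvergesOnDisc f r → NewtonEdge f r k l M →
    ∃ (S : Multiset K) (u : ℕ → K) (M' : ℝ), S.card = l ∧ S.countP (‖·‖ < r) = k ∧
      (∀ a ∈ S, ‖a‖ ≤ r) ∧ ConvergesOnDisc u r ∧ NewtonEdge u r 0 0 M' ∧
      ∀ x, ‖x‖ ≤ r → seriesEval f x = (S.map fun a => x - a).prod * seriesEval u x := by
  induction l with
  | zero =>
    intro f k M hf h
    obtain rfl : k = 0 := Nat.le_zero.1 h.left_le_right
    exact ⟨0, f, M, by simp, by simp, by simp, hf, h, by simp⟩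
  | succ l ih =>
    intro f k M hf h
    obtain ⟨a, ha, h0⟩ := exists_seriesEval_eq_zero hr hf h (Nat.succ_pos l)
    have hz := coeff_zero_eq_seriesQuot hf ha
    rw [h0, zero_sub] at hz
    have hs := coeff_succ_eq_seriesQuot hr hf ha
    have hq := hf.quot hr ha
    have hne : ∃ n, seriesQuot f a n ≠ 0 := by
      by_contra! hq0
      have := h.right
      rw [hs, hq0, hq0] at this
      simp at this
      exact h.pos.ne this
    obtain ⟨n, hn⟩ := hne
    obtain ⟨k', l', M', hE⟩ := hq.exists_newtonEdge hr hn
    obtain ⟨hk, hl, -⟩ := (hE.mul_X_sub hr hz hs).unique h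
    rw [if_pos ha] at hl
    obtain rfl : l' = l := by omega
    obtain ⟨S, u, M'', hcard, hcount, hS, hu, hu', hfac⟩ := ih hq hE
    refine ⟨a ::ₘ S, u, M'', by simp [hcard], by rw [Multiset.countP_cons, hcount, hk], ?_, hu,
      hu', fun x hx => ?_⟩
    · intro b hb
      rcases Multiset.mem_cons.1 hb with rfl | hb
      · exact ha
      · exact hS b hb
    · rw [seriesEval_eq_add_sub_mul hr hf ha hx, h0, zero_add, hfac x hx, Multiset.map_cons,
        Multiset.prod_cons, mul_assoc]

omit [IsUltrametricDist K] [CompleteSpace K] in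
open scoped Classical in
lemma analyticOrderAt_multiset_prod_sub (S : Multiset K) (x : K) :
    AnalyticAt K (fun z => (S.map fun a => z - a).prod) x ∧
      analyticOrderAt (fun z => (S.map fun a => z - a).prod) x = S.count x := by
  induction S using Multiset.induction_on with
  | empty =>
    refine ⟨by simpa using analyticAt_const, ?_⟩
    simp [analyticOrderAt_eq_zero]
  | cons a S ih =>
    have ha : AnalyticAt K (fun z => z - a) x := by fun_prop
    have e : (fun z => ((a ::ₘ S).map fun a => z - a).prod) =
        (fun z => z - a) * fun z => (S.map fun a => z - a).prod := by
      funext z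
      simp
    rw [e]
    refine ⟨ha.mul ih.1, ?_⟩
    rw [analyticOrderAt_mul ha ih.1, ih.2, Multiset.count_cons]
    split_ifs with hxa
    · subst hxa
      have : analyticOrderAt (fun z => z - x) x = (1 : ℕ) := by
        rw [ha.analyticOrderAt_eq_natCast]
        exact ⟨fun _ => 1, analyticAt_const, one_ne_zero, by simp⟩
      rw [this, add_comm]
      push_cast
      rfl
    · have : analyticOrderAt (fun z => z - a) x = 0 :=
        ha.analyticOrderAt_eq_zero.2 (sub_ne_zero.2 hxa)
      rw [this]
      simp

/-- The number of roots on the circle of radius `r` is the length of the Newton edge. -/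
theorem exists_finset_roots_on_circle [IsAlgClosed K] {f : ℕ → K} {r : ℝ} (hr : 0 < r)
    (hf : ConvergesOnDisc f r) {k l : ℕ} {M : ℝ} (h : NewtonEdge f r k l M) :
    ∃ s : Finset K, (∀ x, x ∈ s ↔ ‖x‖ = r ∧ seriesEval f x = 0) ∧
      ∑ x ∈ s, analyticOrderAt (seriesEval f) x = ((l - k : ℕ) : ℕ∞) := by
  classical
  obtain ⟨S, u, M', hcard, hcount, hS, hu, hu', hfac⟩ := exists_factorization hr hf h
  have hroot : ∀ x, ‖x‖ ≤ r → (seriesEval f x = 0 ↔ x ∈ S) := by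
    intro x hx
    rw [hfac x hx, mul_eq_zero, or_iff_left (seriesEval_ne_zero hr hu hu' hx),
      Multiset.prod_eq_zero_iff, Multiset.mem_map]
    constructor
    · rintro ⟨a, ha, hxa⟩
      rwa [sub_eq_zero.1 hxa]
    · exact fun hx => ⟨x, hx, sub_self x⟩
  have horder : ∀ x, ‖x‖ ≤ r → analyticOrderAt (seriesEval f) x = S.count x := by
    intro x hx
    -- In an ultrametric field the ball of radius `r` around `x` stays inside the closed disc, even
    -- when `‖x‖ = r`, so the factorization holds near `x`.
    have he : seriesEval f =ᶠ[𝓝 x] (fun z => (S.map fun a => z - a).prod) * seriesEval u := by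
      filter_upwards [Metric.ball_mem_nhds x hr] with z hz
      refine hfac z ?_
      have : z = (z - x) + x := by ring
      rw [this]
      exact (IsUltrametricDist.norm_add_le_max _ _).trans
        (max_le (by simpa [dist_eq_norm] using (Metric.mem_ball.1 hz).le) hx)
    obtain ⟨h1, h2⟩ := analyticOrderAt_multiset_prod_sub S x
    have hua := hu.analyticAt hr hx
    rw [analyticOrderAt_congr he, analyticOrderAt_mul h1 hua, h2,
      hua.analyticOrderAt_eq_zero.2 (seriesEval_ne_zero hr hu hu' hx), add_zero]
  refine ⟨(S.filter (‖·‖ = r)).toFinset, fun x => ?_, ?_⟩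
  · rw [Multiset.mem_toFinset, Multiset.mem_filter]
    constructor
    · rintro ⟨hx, hxr⟩
      exact ⟨hxr, (hroot x hxr.le).2 hx⟩
    · rintro ⟨hxr, hx⟩
      exact ⟨(hroot x hxr.le).1 hx, hxr⟩
  · have e1 : ∀ x ∈ (S.filter (‖·‖ = r)).toFinset,
        analyticOrderAt (seriesEval f) x = (((S.filter (‖·‖ = r)).count x : ℕ) : ℕ∞) := by
      intro x hx
      rw [Multiset.mem_toFinset, Multiset.mem_filter] at hx
      rw [horder x hx.2.le, Multiset.count_filter_of_pos (p := (‖·‖ = r)) hx.2]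
    rw [Finset.sum_congr rfl e1, ← Nat.cast_sum, Multiset.toFinset_sum_count_eq]
    congr 1
    have e2 : S.filter (‖·‖ = r) = S.filter (fun a => ¬ ‖a‖ < r) := by
      refine Multiset.filter_congr fun a ha => ?_
      exact ⟨fun h => h.not_lt, fun h' => le_antisymm (hS a ha) (not_lt.1 h')⟩
    have e3 := congrArg Multiset.card (Multiset.filter_add_not (‖·‖ < r) S)
    rw [Multiset.card_add, ← Multiset.countP_eq_card_filter, hcount, hcard] at e3
    rw [e2]
    omega

end UltrametricSeries

/-! ### Slopes, the characteristic sequence and its edges -/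

section CharacteristicSequence

/-- Enlarging the radius favours the term of higher degree. This plays the role of convexity of the
Newton polygon. -/
lemma mul_pow_lt_mul_pow_of_le {x y r r' : ℝ} {i j : ℕ} (hr : 0 < r) (hrr : r < r') (hy : 0 < y)
    (hij : i < j) (h : x * r ^ i ≤ y * r ^ j) : x * r' ^ i < y * r' ^ j := by
  obtain ⟨d, rfl⟩ := Nat.exists_eq_add_of_lt hij
  have hr' := hr.trans hrr
  have h1 : x ≤ y * r ^ (d + 1) := by
    refine le_of_mul_le_mul_right ?_ (pow_pos hr i)
    calc _ ≤ _ := h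
      _ = _ := by ring
  calc x * r' ^ i ≤ y * r ^ (d + 1) * r' ^ i := by gcongr
    _ < y * r' ^ (d + 1) * r' ^ i := by gcongr
    _ = _ := by ring

variable {p : ℕ} [Fact p.Prime]

/-- The valuation of the elements of norm `r`. -/
noncomputable def radiusVal (p : ℕ) (r : ℝ) : EReal := ((-Real.logb p r : ℝ) : EReal)

lemma one_lt_cast_prime (p : ℕ) [hp : Fact p.Prime] : (1 : ℝ) < p := by
  exact_mod_cast hp.out.one_lt

lemma radiusVal_lt_radiusVal {r r' : ℝ} (hr : 0 < r) (h : r < r') :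
    radiusVal p r' < radiusVal p r := by
  rw [radiusVal, radiusVal, EReal.coe_lt_coe_iff, neg_lt_neg_iff]
  exact Real.logb_lt_logb (one_lt_cast_prime p) hr h

lemma vp_eq_radiusVal_iff {x : ℂ_[p]} {r : ℝ} (hr : 0 < r) : vp p x = radiusVal p r ↔ ‖x‖ = r := by
  rw [vp, radiusVal]
  split_ifs with hx
  · simpa [hx, hr.ne] using (EReal.coe_ne_top (-Real.logb p r)).symm
  · rw [EReal.coe_eq_coe_iff, neg_inj]
    exact (Real.logb_injOn_pos (one_lt_cast_prime p)).eq_iff (norm_pos_iff.2 hx) hr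

lemma exists_eq_radiusVal (p : ℕ) [Fact p.Prime] (c : ℝ) :
    ∃ r, 0 < r ∧ (c : EReal) = radiusVal p r := by
  have hp := one_lt_cast_prime p
  refine ⟨(p : ℝ) ^ (-c), by positivity, ?_⟩
  rw [radiusVal, Real.logb_rpow (by positivity) hp.ne', neg_neg]

variable {F : PowerSeries ℂ_[p]}

lemma slopeBetween_eq_bot {a n : ℕ} (han : a < n) (ha : PowerSeries.coeff a F ≠ 0)
    (hn : PowerSeries.coeff n F = 0) : slopeBetween F a n = ⊥ := by
  have : (0 : ℝ) < (n : ℝ) - a := sub_pos.2 (by exact_mod_cast han)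
  rw [slopeBetween, vp, vp, if_neg ha, if_pos hn, EReal.sub_top]
  exact EReal.bot_div_of_pos_ne_top (by exact_mod_cast this) (EReal.coe_ne_top _)

lemma slopeBetween_eq_coe {a n : ℕ} (ha : PowerSeries.coeff a F ≠ 0)
    (hn : PowerSeries.coeff n F ≠ 0) : slopeBetween F a n =
      (((Real.logb p ‖PowerSeries.coeff n F‖ - Real.logb p ‖PowerSeries.coeff a F‖) / (n - a) : ℝ) :
        EReal) := by
  rw [slopeBetween, vp, vp, if_neg ha, if_neg hn, ← EReal.coe_sub, ← EReal.coe_div]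
  congr 2
  ring

lemma slopeBetween_le_iff {a n : ℕ} (han : a < n) (ha : PowerSeries.coeff a F ≠ 0) {r : ℝ}
    (hr : 0 < r) : slopeBetween F a n ≤ radiusVal p r ↔
      ‖PowerSeries.coeff n F‖ * r ^ n ≤ ‖PowerSeries.coeff a F‖ * r ^ a := by
  by_cases hn : PowerSeries.coeff n F = 0
  · rw [slopeBetween_eq_bot han ha hn, hn]
    simp only [bot_le, norm_zero, zero_mul, true_iff]
    positivity
  · have hd : (0 : ℝ) < (n : ℝ) - a := sub_pos.2 (by exact_mod_cast han)
    have ha' := norm_pos_iff.2 ha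
    have hn' := norm_pos_iff.2 hn
    rw [slopeBetween_eq_coe ha hn, radiusVal, EReal.coe_le_coe_iff, div_le_iff₀ hd,
      ← Real.logb_le_logb (one_lt_cast_prime p)
        (mul_pos hn' (pow_pos hr _)) (mul_pos ha' (pow_pos hr _)),
      Real.logb_mul hn'.ne' (by positivity), Real.logb_mul ha'.ne' (by positivity),
      Real.logb_pow, Real.logb_pow]
    constructor <;> intro h <;> linarith

lemma le_slopeBetween_iff {a n : ℕ} (han : a < n) (ha : PowerSeries.coeff a F ≠ 0) {r : ℝ}
    (hr : 0 < r) : radiusVal p r ≤ slopeBetween F a n ↔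
      ‖PowerSeries.coeff a F‖ * r ^ a ≤ ‖PowerSeries.coeff n F‖ * r ^ n := by
  have ha' := norm_pos_iff.2 ha
  by_cases hn : PowerSeries.coeff n F = 0
  · rw [slopeBetween_eq_bot han ha hn, hn]
    simp only [norm_zero, zero_mul, le_bot_iff]
    refine iff_of_false (EReal.coe_ne_bot _) (not_le.2 (by positivity))
  · have hd : (0 : ℝ) < (n : ℝ) - a := sub_pos.2 (by exact_mod_cast han)
    have hn' := norm_pos_iff.2 hn
    rw [slopeBetween_eq_coe ha hn, radiusVal, EReal.coe_le_coe_iff, le_div_iff₀ hd,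
      ← Real.logb_le_logb (one_lt_cast_prime p)
        (mul_pos ha' (pow_pos hr _)) (mul_pos hn' (pow_pos hr _)),
      Real.logb_mul hn'.ne' (by positivity), Real.logb_mul ha'.ne' (by positivity),
      Real.logb_pow, Real.logb_pow]
    constructor <;> intro h <;> linarith

lemma slopeBetween_eq_iff {a n : ℕ} (han : a < n) (ha : PowerSeries.coeff a F ≠ 0) {r : ℝ}
    (hr : 0 < r) : slopeBetween F a n = radiusVal p r ↔
      ‖PowerSeries.coeff n F‖ * r ^ n = ‖PowerSeries.coeff a F‖ * r ^ a := by
  rw [le_antisymm_iff, le_antisymm_iff, slopeBetween_le_iff han ha hr, le_slopeBetween_iff han ha hr]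

lemma slopeBetween_lt_iff {a n : ℕ} (han : a < n) (ha : PowerSeries.coeff a F ≠ 0) {r : ℝ}
    (hr : 0 < r) : slopeBetween F a n < radiusVal p r ↔
      ‖PowerSeries.coeff n F‖ * r ^ n < ‖PowerSeries.coeff a F‖ * r ^ a := by
  rw [← not_le, ← not_le, le_slopeBetween_iff han ha hr]

lemma exists_slopeBetween_eq_radiusVal {a n : ℕ} (ha : PowerSeries.coeff a F ≠ 0)
    (hn : PowerSeries.coeff n F ≠ 0) : ∃ r, 0 < r ∧ slopeBetween F a n = radiusVal p r := by
  rw [slopeBetween_eq_coe ha hn]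
  exact exists_eq_radiusVal p _

/-- If the maximal slope were `⊥`, it would also be attained at `b + 1`, so `b` would not be the
largest maximizer. -/
lemma IsNextBreak.coeff_ne_zero {a b : ℕ} (h : IsNextBreak F a b)
    (ha : PowerSeries.coeff a F ≠ 0) : PowerSeries.coeff b F ≠ 0 := by
  intro hb
  obtain ⟨hab, hle, heq⟩ := h
  have hbot := slopeBetween_eq_bot hab ha hb
  have h1 := hle (b + 1) (by omega)
  rw [hbot, le_bot_iff] at h1
  have := heq (b + 1) (by omega) (h1.trans hbot.symm)
  omega

lemma charSeq_succ_eq_some {n b : ℕ} (h : charSeq F (n + 1) = some b) :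
    ∃ a, charSeq F n = some a ∧ IsNextBreak F a b := by
  rw [charSeq, Option.bind_eq_some_iff] at h
  obtain ⟨a, ha, hb⟩ := h
  split_ifs at hb with hex
  refine ⟨a, ha, ?_⟩
  rw [← Option.some.inj hb]
  exact hex.choose_spec

lemma exists_charSeq_succ {n a : ℕ} (h : charSeq F n = some a) (hex : ∃ b, IsNextBreak F a b) :
    ∃ b, charSeq F (n + 1) = some b ∧ IsNextBreak F a b := by
  refine ⟨hex.choose, ?_, hex.choose_spec⟩
  rw [charSeq, h, Option.bind_some, dif_pos hex]

lemma coeff_charSeq_ne_zero (hF : PowerSeries.coeff 0 F ≠ 0) {n k : ℕ}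
    (h : charSeq F n = some k) : PowerSeries.coeff k F ≠ 0 := by
  induction n generalizing k with
  | zero =>
    obtain rfl : 0 = k := Option.some.inj h
    exact hF
  | succ n ih =>
    obtain ⟨a, ha, hb⟩ := charSeq_succ_eq_some h
    exact hb.coeff_ne_zero (ih ha)

/-- Consecutive terms of the characteristic sequence are the end points of a Newton edge. -/
lemma newtonEdge_of_charSeq (hF : PowerSeries.coeff 0 F ≠ 0) {n a b : ℕ}
    (ha : charSeq F n = some a) (hb : charSeq F (n + 1) = some b) :
    ∃ r, 0 < r ∧ slopeBetween F a b = radiusVal p r ∧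
      NewtonEdge (fun i => PowerSeries.coeff i F) r a b (‖PowerSeries.coeff a F‖ * r ^ a) := by
  induction n generalizing a b with
  | zero =>
    obtain rfl : 0 = a := Option.some.inj ha
    obtain ⟨a', ha', hbr⟩ := charSeq_succ_eq_some hb
    obtain rfl : 0 = a' := Option.some.inj (ha.symm.trans ha')
    obtain ⟨r, hr, hs⟩ := exists_slopeBetween_eq_radiusVal hF (hbr.coeff_ne_zero hF)
    obtain ⟨hab, hle, heq⟩ := hbr
    rw [hs] at hle heq
    have hF' := norm_pos_iff.2 hF
    refine ⟨r, hr, hs, by positivity, fun i => ?_, rfl, (slopeBetween_eq_iff hab hF hr).1 hs,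
      fun i hi => by omega, fun i hi => ?_⟩
    · rcases Nat.eq_zero_or_pos i with rfl | hi
      · rfl
      · exact (slopeBetween_le_iff hi hF hr).1 (hle i hi)
    · have hi' : 0 < i := by omega
      refine (slopeBetween_lt_iff hi' hF hr).1 ((hle i hi').lt_of_ne fun he => ?_)
      exact absurd (heq i hi' he) (by omega)
  | succ n ih =>
    obtain ⟨b', hb', hbr⟩ := charSeq_succ_eq_some hb
    obtain rfl : a = b' := Option.some.inj (ha.symm.trans hb')
    obtain ⟨c, hc, -⟩ := charSeq_succ_eq_some ha
    obtain ⟨r₀, hr₀, -, hE⟩ := ih hc ha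
    have hF0 := coeff_charSeq_ne_zero hF ha
    have hFb := hbr.coeff_ne_zero hF0
    have hF' := norm_pos_iff.2 hF0
    have hFb' := norm_pos_iff.2 hFb
    obtain ⟨r, hr, hs⟩ := exists_slopeBetween_eq_radiusVal hF0 hFb
    obtain ⟨hab, hle, heq⟩ := hbr
    have hends := (slopeBetween_eq_iff hab hF0 hr).1 hs
    -- At `r₀` the term `b` is strictly below the term `a`, the right end of the previous edge; at
    -- `r` they are equal.
    have hrr : r₀ < r := by
      by_contra! hcon
      have h1 := hE.lt_right b hab
      rw [← hE.right] at h1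
      rcases hcon.eq_or_lt with rfl | hlt
      · exact h1.ne hends
      · exact h1.not_ge (mul_pow_lt_mul_pow_of_le hr hlt hFb' hab hends.ge).le
    rw [hs] at hle heq
    have hlt : ∀ i < a, ‖PowerSeries.coeff i F‖ * r ^ i < ‖PowerSeries.coeff a F‖ * r ^ a :=
      fun i hi => mul_pow_lt_mul_pow_of_le hr₀ hrr hF' hi ((hE.le i).trans_eq hE.right.symm)
    refine ⟨r, hr, hs, by positivity, fun i => ?_, rfl, hends, hlt, fun i hi => ?_⟩
    · rcases lt_trichotomy i a with hi | rfl | hi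
      · exact (hlt i hi).le
      · rfl
      · exact (slopeBetween_le_iff hi hF0 hr).1 (hle i hi)
    · have hi' : a < i := by omega
      refine (slopeBetween_lt_iff hi' hF0 hr).1 ((hle i hi').lt_of_ne fun he => ?_)
      exact absurd (heq i hi' he) (by omega)

lemma slopeBetween_charSeq_succ_lt (hF : PowerSeries.coeff 0 F ≠ 0) {n a b c : ℕ}
    (ha : charSeq F n = some a) (hb : charSeq F (n + 1) = some b)
    (hc : charSeq F (n + 2) = some c) : slopeBetween F b c < slopeBetween F a b := by
  obtain ⟨r, hr, hs, hE⟩ := newtonEdge_of_charSeq hF ha hb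
  obtain ⟨b', hb', hbr⟩ := charSeq_succ_eq_some hc
  obtain rfl : b = b' := Option.some.inj (hb.symm.trans hb')
  rw [hs, slopeBetween_lt_iff hbr.1 (coeff_charSeq_ne_zero hF hb) hr]
  exact (hE.lt_right c hbr.1).trans_eq hE.right.symm

lemma slopeBetween_charSeq_lt (hF : PowerSeries.coeff 0 F ≠ 0) {i j a b c d : ℕ} (hij : i < j)
    (ha : charSeq F i = some a) (hb : charSeq F (i + 1) = some b)
    (hc : charSeq F j = some c) (hd : charSeq F (j + 1) = some d) :
    slopeBetween F c d < slopeBetween F a b := by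
  induction j, hij using Nat.le_induction generalizing c d with
  | base =>
    obtain rfl : b = c := Option.some.inj (hb.symm.trans hc)
    exact slopeBetween_charSeq_succ_lt hF ha hb hd
  | succ j hj ih =>
    obtain ⟨e, he, -⟩ := charSeq_succ_eq_some hc
    exact (slopeBetween_charSeq_succ_lt hF he hc hd).trans (ih he hc)

lemma ConvergesAt.convergesOnDisc {x : ℂ_[p]} (h : ConvergesAt F x) :
    ConvergesOnDisc (fun i => PowerSeries.coeff i F) ‖x‖ := by
  have := (Summable.tendsto_atTop_zero h).norm
  simpa [ConvergesOnDisc] using this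

lemma NewtonEdge.convergesOnDisc {f : ℕ → ℂ_[p]} {r r' : ℝ} {k l : ℕ} {M : ℝ}
    (h : NewtonEdge f r' k l M) (hr : 0 < r) (hrr : r < r') : ConvergesOnDisc f r := by
  have hr' := hr.trans hrr
  refine squeeze_zero (g := fun n => M * (r / r') ^ n) (fun n => by positivity) (fun n => ?_) ?_
  · calc ‖f n‖ * r ^ n = ‖f n‖ * r' ^ n * (r / r') ^ n := by
          rw [div_pow]; field_simp
      _ ≤ _ := by gcongr; exact h.le n
  · simpa using (tendsto_pow_atTop_nhds_zero_of_lt_one (by positivity)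
      ((div_lt_one hr').2 hrr)).const_mul M

/-- If the dominant terms of `F` at radius `r` start at `k`, any term `a < k` of the
characteristic sequence is followed by another one, at most `k`. -/
lemma NewtonEdge.exists_isNextBreak {r : ℝ} (hr : 0 < r) {k l : ℕ} {M : ℝ}
    (hE : NewtonEdge (fun i => PowerSeries.coeff i F) r k l M) {a : ℕ} (hak : a < k)
    (ha : PowerSeries.coeff a F ≠ 0) :
    (∃ b, IsNextBreak F a b) ∧ ∀ b, IsNextBreak F a b → b ≤ k := by
  have hk : PowerSeries.coeff k F ≠ 0 := by
    intro h0
    have := hE.left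
    rw [h0, norm_zero, zero_mul] at this
    exact hE.pos.ne this
  have hk' := norm_pos_iff.2 hk
  obtain ⟨s, hs, hsl⟩ := exists_slopeBetween_eq_radiusVal ha hk
  have hends := (slopeBetween_eq_iff hak ha hs).1 hsl
  have hsr : s < r := by
    by_contra! hcon
    have h1 := hE.lt_left a hak
    rw [← hE.left] at h1
    rcases hcon.eq_or_lt with rfl | hlt
    · exact h1.ne hends.symm
    · exact (mul_pow_lt_mul_pow_of_le hr hlt hk' hak h1.le).ne hends.symm
  -- A term beyond `k` that matched term `k` at radius `s` would exceed it at the larger radius `r`,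
  -- where term `k` is maximal.
  have hgt : ∀ n, k < n → slopeBetween F a n < slopeBetween F a k := by
    intro n hn
    rw [hsl, slopeBetween_lt_iff (hak.trans hn) ha hs, ← hends]
    by_contra! hcon
    have hn0 : 0 < ‖PowerSeries.coeff n F‖ := by
      refine (norm_nonneg _).lt_of_ne fun h0 => ?_
      rw [← h0, zero_mul] at hcon
      exact hcon.not_gt (by positivity)
    exact (mul_pow_lt_mul_pow_of_le hs hsr hn0 hn hcon).not_ge ((hE.le n).trans_eq hE.left.symm)
  constructor
  -- The lexicographic order selects the largest index among those of maximal slope.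
  · obtain ⟨b, hb, hmax⟩ := (Finset.Ioc a k).exists_max_image
      (fun n => toLex (slopeBetween F a n, n)) ⟨k, by simp [hak]⟩
    rw [Finset.mem_Ioc] at hb
    have hle : ∀ n, a < n → n ≤ k → slopeBetween F a n < slopeBetween F a b ∨
        slopeBetween F a n = slopeBetween F a b ∧ n ≤ b := fun n h1 h2 => by
      simpa [Prod.Lex.toLex_le_toLex] using hmax n (Finset.mem_Ioc.2 ⟨h1, h2⟩)
    have hkb : slopeBetween F a k ≤ slopeBetween F a b :=
      (hle k hak le_rfl).elim le_of_lt fun h => h.1.le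
    refine ⟨b, hb.1, fun n hn => ?_, fun n hn he => ?_⟩
    · rcases le_or_gt n k with h | h
      · exact (hle n hn h).elim le_of_lt fun h => h.1.le
      · exact (hgt n h).le.trans hkb
    · rcases le_or_gt n k with h | h
      · exact (hle n hn h).elim (fun h => absurd he h.ne) fun h => h.2
      · exact absurd he ((hgt n h).trans_le hkb).ne
  · intro b hb
    by_contra! hcon
    exact (hb.2.1 k hak).not_gt (hgt b hcon)

lemma NewtonEdge.exists_charSeq_eq (hF : PowerSeries.coeff 0 F ≠ 0) {r : ℝ} (hr : 0 < r)
    {k l : ℕ} {M : ℝ} (hE : NewtonEdge (fun i => PowerSeries.coeff i F) r k l M) :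
    ∃ n, charSeq F n = some k := by
  -- The sequence advances strictly without jumping over `k`, so the distance `d` to `k` descends to
  -- zero.
  suffices H : ∀ d n a, charSeq F n = some a → a + d = k → ∃ n, charSeq F n = some k from
    H k 0 0 rfl (zero_add k)
  intro d
  induction d using Nat.strong_induction_on with
  | _ d ih =>
    intro n a ha had
    rcases Nat.eq_zero_or_pos d with rfl | hd
    · exact ⟨n, by rw [ha, ← had, add_zero]⟩
    · obtain ⟨hex, hle⟩ := hE.exists_isNextBreak hr (by omega) (coeff_charSeq_ne_zero hF ha)
      obtain ⟨b, hb, hbr⟩ := exists_charSeq_succ ha hex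
      have h1 := hle b hbr
      have h2 := hbr.1
      exact ih (k - b) (by omega) (n + 1) b hb (by omega)

lemma exists_charSeq_of_isSeriesRoot (hF : PowerSeries.coeff 0 F ≠ 0) {x : ℂ_[p]}
    (hx : IsSeriesRoot F x) : ∃ n a b : ℕ, charSeq F n = some a ∧ charSeq F (n + 1) = some b ∧
      vp p x = slopeBetween F a b := by
  obtain ⟨hconv, hroot⟩ := hx
  have hdisc := hconv.convergesOnDisc
  have hx0 : x ≠ 0 := by
    rintro rfl
    rw [evalSeries, tsum_eq_single 0 fun n hn => by simp [hn]] at hroot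
    exact hF (by simpa using hroot)
  have hr : 0 < ‖x‖ := norm_pos_iff.2 hx0
  obtain ⟨k, l, M, hE⟩ := hdisc.exists_newtonEdge (i₀ := 0) hr hF
  -- An edge of length zero would give the root `x` order of vanishing zero.
  have hkl : k < l := by
    refine hE.left_le_right.lt_of_ne fun he => ?_
    subst he
    obtain ⟨s, hs, hsum⟩ := exists_finset_roots_on_circle hr hdisc hE
    rw [Nat.sub_self, Nat.cast_zero, Finset.sum_eq_zero_iff] at hsum
    have h0 := hsum x ((hs x).2 ⟨rfl, hroot⟩)
    exact (hdisc.analyticAt hr le_rfl).analyticOrderAt_eq_zero.1 h0 hroot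
  obtain ⟨n, hn⟩ := hE.exists_charSeq_eq hF hr
  have hk := coeff_charSeq_ne_zero hF hn
  have hsl : slopeBetween F k l = radiusVal p ‖x‖ :=
    (slopeBetween_eq_iff hkl hk hr).2 (hE.right.trans hE.left.symm)
  have hbr : IsNextBreak F k l := by
    refine ⟨hkl, fun m hm => ?_, fun m hm he => ?_⟩
    · rw [hsl, slopeBetween_le_iff hm hk hr]
      exact (hE.le m).trans_eq hE.left.symm
    · rw [hsl, slopeBetween_eq_iff hm hk hr] at he
      by_contra! hlt
      exact (hE.lt_right m hlt).ne (he.trans hE.left)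
  obtain ⟨b, hb, hbr'⟩ := exists_charSeq_succ hn ⟨l, hbr⟩
  refine ⟨n, k, b, hn, hb, ?_⟩
  rw [(vp_eq_radiusVal_iff hr).2 rfl, ← hsl]
  exact le_antisymm (hbr'.2.1 l hkl) (hbr.2.1 b hbr'.1)

lemma exists_finset_roots_of_charSeq (hF : PowerSeries.coeff 0 F ≠ 0) {n a b : ℕ}
    (ha : charSeq F n = some a) (hb : charSeq F (n + 1) = some b)
    (h : (∃ c, charSeq F (n + 2) = some c) ∨
      ∃ x : ℂ_[p], vp p x = slopeBetween F a b ∧ ConvergesAt F x) :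
    ∃ s : Finset ℂ_[p], (∀ x : ℂ_[p], x ∈ s ↔ IsSeriesRoot F x ∧ vp p x = slopeBetween F a b) ∧
      ∑ x ∈ s, analyticOrderAt (evalSeries F) x = ((b - a : ℕ) : ℕ∞) := by
  obtain ⟨r, hr, hs, hE⟩ := newtonEdge_of_charSeq hF ha hb
  have hdisc : ConvergesOnDisc (fun i => PowerSeries.coeff i F) r := by
    -- A further term of the sequence gives an edge at a larger radius; the terms are bounded there,
    -- hence tend to zero at `r`.
    rcases h with ⟨c, hc⟩ | ⟨x, hx, hconv⟩
    · obtain ⟨r', hr', hs', hE'⟩ := newtonEdge_of_charSeq hF hb hc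
      refine hE'.convergesOnDisc hr ?_
      have hlt := slopeBetween_charSeq_succ_lt hF ha hb hc
      rw [hs, hs'] at hlt
      by_contra! hle
      rcases hle.eq_or_lt with rfl | h1
      · exact lt_irrefl _ hlt
      · exact hlt.not_gt (radiusVal_lt_radiusVal hr' h1)
    · rw [hs, vp_eq_radiusVal_iff hr] at hx
      exact hx ▸ hconv.convergesOnDisc
  obtain ⟨s, hmem, hsum⟩ := exists_finset_roots_on_circle hr hdisc hE
  refine ⟨s, fun x => ?_, hsum⟩
  rw [hmem, hs, vp_eq_radiusVal_iff hr]
  constructor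
  · rintro ⟨hx, h0⟩
    exact ⟨⟨hdisc.summable hx.le, h0⟩, hx⟩
  · rintro ⟨⟨-, h0⟩, hx⟩
    exact ⟨hx, h0⟩

end CharacteristicSequence

theorem theorem4p1 (p : ℕ) [Fact p.Prime] (F : PowerSeries ℂ_[p])
    (hF : PowerSeries.coeff 0 F ≠ 0) :
    -- the coefficients at the breakpoints are nonzero, so the slopes are real numbers
    (∀ n k : ℕ, charSeq F n = some k → PowerSeries.coeff k F ≠ 0) ∧
    -- the slopes are strictly decreasing
    (∀ i j a b c d : ℕ, i < j → charSeq F i = some a → charSeq F (i + 1) = some b →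
      charSeq F j = some c → charSeq F (j + 1) = some d →
      slopeBetween F c d < slopeBetween F a b) ∧
    -- the number of roots of each slope, counted with multiplicity; the only slope left out is
    -- a last one such that `F` converges nowhere on the corresponding circle
    (∀ n a b : ℕ, charSeq F n = some a → charSeq F (n + 1) = some b →
      ((∃ c, charSeq F (n + 2) = some c) ∨
        (∃ x : ℂ_[p], vp p x = slopeBetween F a b ∧ ConvergesAt F x)) →
      ∃ s : Finset ℂ_[p],
        (∀ x : ℂ_[p], x ∈ s ↔ IsSeriesRoot F x ∧ vp p x = slopeBetween F a b) ∧
        ∑ x ∈ s, analyticOrderAt (evalSeries F) x = ((b - a : ℕ) : ℕ∞)) ∧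
    -- every root occurs in one of these groups
    (∀ x : ℂ_[p], IsSeriesRoot F x →
      ∃ n a b : ℕ, charSeq F n = some a ∧ charSeq F (n + 1) = some b ∧
        vp p x = slopeBetween F a b) := by
  exact ⟨fun _ _ => coeff_charSeq_ne_zero hF,
    fun _ _ _ _ _ _ => slopeBetween_charSeq_lt hF,
    fun _ _ _ => exists_finset_roots_of_charSeq hF,
    fun _ => exists_charSeq_of_isSeriesRoot hF⟩
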